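/- Call a pair $(x,y)\in\mathbb Z^6\times\mathbb Z^6$, $x=(x_1,\dots,x_6)$, $y=(y_1,\dots,y_6)$, a solution if $$x_1^k+x_2^k+x_3^k+x_4^k+x_5^k+x_6^k=y_1^k+y_2^k+y_3^k+y_4^k+y_5^k+y_6^k\qquad\text{simultaneously for } k=1,2,3,9.$$ Call a solution nontrivial if $x_i\ne y_j$, $x_i+x_j\neq 0$ and $y_i+y_j\ne 0$ for all $i,j\in\{1,\dots,6\}$ (including $i=j$, so that no term is zero), and primitive if $\gcd(x_1,\dots,x_6,y_1,\dots,y_6)=1$. There are infinitely many nontrivial primitive solutions. In particular, infinitely many nontrivial solutions are pairwise distinct even up to scaling, permuting the terms on each side, and interchanging the two sides. -/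

import Mathlib

/-- `x₁ᵏ + ⋯ + x₆ᵏ = y₁ᵏ + ⋯ + y₆ᵏ` simultaneously for `k = 1, 2, 3, 9`. -/
def IsSolution (x y : Fin 6 → ℤ) : Prop :=
  ∀ k : ℕ, k = 1 ∨ k = 2 ∨ k = 3 ∨ k = 9 → ∑ i, x i ^ k = ∑ i, y i ^ k

/-- No term can be deleted from the equation of ninth powers: no integer occurs on both sides,
and no two terms on the same side are opposite to each other. The case `i = j` of the last two
clauses says that no term is zero. -/
def IsNontrivial (x y : Fin 6 → ℤ) : Prop :=
  (∀ i j, x i ≠ y j) ∧ (∀ i j, x i + x j ≠ 0) ∧ (∀ i j, y i + y j ≠ 0)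

/-- The twelve integers have no common divisor other than `1` and `-1`. Every nonzero solution is an
integer multiple of a primitive one, which is unique up to sign. -/
def IsPrimitive (x y : Fin 6 → ℤ) : Prop :=
  ∀ d : ℤ, (∀ i, d ∣ x i ∧ d ∣ y i) → IsUnit d

/-!
Let `u` and `v` be triples of sum zero with the same sum of squares `2 N`, and consider
`x = (2 d + u, d - u)` and `y = (2 d + v, d - v)`. The sums of first, second and third powers
agree for every `d`. If `q` and `q'` denote the products of the entries of `u` and `v`, the
difference of the sums of ninth powers is a multiple of

`(q - q') * d * (21 d ^ 2 + 2 N) * (7 d (2 d ^ 2 + N) + 2 (q + q'))`;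

so it suffices that the last factor, a cubic, vanishes. The quadric of pairs `(u, v)` contains the
plane `u = (2 a + 4 b, 5 a - 3 b, -7 a - b)`, `v = (2 a - 4 b, 5 a + 3 b, -7 a + b)`. On it the
cubic factor becomes, with `d = 4 c`, the plane cubic

`b ^ 2 (13 c + 10 a) + 32 c ^ 3 + 39 c a ^ 2 - 10 a ^ 3 = 0`

(`sum_pow_left_eq_sum_pow_right`), which is the elliptic curve `Y ^ 2 = X ^ 3 + (13 X + 444) ^ 2`
in other coordinates.

This curve has positive rank. The point `(-999 / 8 ^ 2, 119325 / 8 ^ 3)` lies in the kernel of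
reduction modulo `2`, and on this kernel each doubling raises the `2`-adic valuation of the
denominator by exactly one (`exists_odd_point`). Hence the iterated doubles are distinct, and they
tend `2`-adically to the point at infinity. The terms of the corresponding solutions, their sums
and their differences are linear forms in `(c, a, b)`; close to the point at infinity the valuations
of the three coordinates are so far apart that a linear form not divisible by a high power of `2`
cannot vanish (`linearForm_ne_zero`). This gives nontriviality. Dividing by the greatest common
divisor gives primitive solutions, and these are distinct because they still determine
the ratio of `c` to `a`.
-/

/-! ### The family of solutions -/

/-- The six terms `(8 c + u, 4 c - u)` with `u = (2 a + 4 b, 5 a - 3 b, -7 a - b)`. The other side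
of the equation is obtained by changing the sign of `b`. -/
def side (c a b : ℤ) (i : Fin 6) : ℤ :=
  ![8, 8, 8, 4, 4, 4] i * c + ![2, 5, -7, -2, -5, 7] i * a + ![4, -3, -1, -4, 3, 1] i * b

theorem sum_pow_left_eq_sum_pow_right {c a b : ℤ}
    (h : b ^ 2 * (13 * c + 10 * a) + 32 * c ^ 3 + 39 * c * a ^ 2 - 10 * a ^ 3 = 0) :
    IsSolution (side c a b) (side c a (-b)) := by
  rintro k (rfl | rfl | rfl | rfl)
  · simp [side, Fin.sum_univ_succ]; ring
  · simp [side, Fin.sum_univ_succ]; ring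
  · simp [side, Fin.sum_univ_succ]; ring
  · simp [side, Fin.sum_univ_succ]
    -- The cofactor is `54 (q - q') d (21 d ^ 2 + 2 N)` for the family described above, where
    -- `q - q' = 24 b ^ 3 - 216 a ^ 2 b` and `N = 39 a ^ 2 + 13 b ^ 2`, and the cubic factor is
    -- `28` times the left-hand side of `h`.
    linear_combination 54 * (24 * b ^ 3 - 216 * a ^ 2 * b) * (4 * c) *
      (336 * c ^ 2 + 78 * a ^ 2 + 26 * b ^ 2) * 28 * h

/-! ### Points on the elliptic curve -/

/-- The numerators and the denominator of a point `(X / Z ^ 2, Y / Z ^ 3)` of the curve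
`Y ^ 2 = X ^ 3 + (13 X + 444) ^ 2`. -/
def OnCurve (X Y Z : ℤ) : Prop :=
  Y ^ 2 = X ^ 3 + Z ^ 2 * (13 * X + 444 * Z ^ 2) ^ 2

/-- The doubling formula; `F` is the derivative of the right-hand side, and `F / (2 Y Z)` is the
slope of the tangent. -/
theorem OnCurve.double {X Y Z F X' : ℤ} (h : OnCurve X Y Z)
    (hF : F = 3 * X ^ 2 + 338 * X * Z ^ 2 + 11544 * Z ^ 4)
    (hX' : X' = F ^ 2 - 4 * (2 * X + 169 * Z ^ 2) * Y ^ 2) :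
    OnCurve X' (F * (4 * X * Y ^ 2 - X') - 8 * Y ^ 4) (2 * Y * Z) := by
  unfold OnCurve at *
  subst hX' hF
  linear_combination 64 * Y ^ 6 * h

/-- The iterated doubles of the point `(-999 / 8 ^ 2, 119325 / 8 ^ 3)`. -/
theorem exists_odd_point (k : ℕ) :
    ∃ X Y w : ℤ, Odd X ∧ Odd Y ∧ Odd w ∧ OnCurve X Y (2 ^ (k + 3) * w) := by
  induction k with
  | zero => exact ⟨-999, 119325, 1, by decide, by decide, by decide, by norm_num [OnCurve]⟩
  | succ k ih =>
    obtain ⟨X, Y, w, hX, hY, hw, h⟩ := ih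
    obtain ⟨F, hF⟩ : ∃ F, F = 3 * X ^ 2 + 338 * X * (2 ^ (k + 3) * w) ^ 2 +
      11544 * (2 ^ (k + 3) * w) ^ 4 := ⟨_, rfl⟩
    obtain ⟨X', hX'⟩ : ∃ X', X' = F ^ 2 - 4 * (2 * X + 169 * (2 ^ (k + 3) * w) ^ 2) * Y ^ 2 :=
      ⟨_, rfl⟩
    have hFodd : Odd F := by
      have : F = 3 * X ^ 2 + 2 * (169 * X * (2 ^ (k + 3) * w) ^ 2 +
          5772 * (2 ^ (k + 3) * w) ^ 4) := by rw [hF]; ring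
      rw [this]
      exact (Odd.mul (by decide) hX.pow).add_even (even_two_mul _)
    have hXodd : Odd X' := by
      have : X' = F ^ 2 - 2 * (2 * (2 * X + 169 * (2 ^ (k + 3) * w) ^ 2) * Y ^ 2) := by
        rw [hX']; ring
      rw [this]
      exact hFodd.pow.sub_even (even_two_mul _)
    refine ⟨X', F * (4 * X * Y ^ 2 - X') - 8 * Y ^ 4, Y * w, hXodd, ?_, hY.mul hw, ?_⟩
    · have : F * (4 * X * Y ^ 2 - X') - 8 * Y ^ 4 =
          2 * (2 * F * X * Y ^ 2 - 4 * Y ^ 4) - F * X' := by ring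
      rw [this]
      exact (even_two_mul _).sub_odd (hFodd.mul hXodd)
    · convert h.double hF hX' using 1
      ring

/-! ### Solutions attached to points -/

/-- The solution attached to the point `(X / Z ^ 2, Y / Z ^ 3)`; the change of sign of `Y`
interchanges its two sides. -/
def pointSide (X Y Z : ℤ) : Fin 6 → ℤ :=
  side (-10 * X * Z) (Z * (13 * X + 1332 * Z ^ 2)) (3 * Y)

theorem OnCurve.isSolution {X Y Z : ℤ} (h : OnCurve X Y Z) :
    IsSolution (pointSide X Y Z) (pointSide X (-Y) Z) := by
  unfold OnCurve at h
  have := sum_pow_left_eq_sum_pow_right (c := -10 * X * Z) (a := Z * (13 * X + 1332 * Z ^ 2))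
    (b := 3 * Y) (by linear_combination 119880 * Z ^ 3 * h)
  simpa [pointSide, mul_neg] using this

/-- A linear form in the coordinates `c`, `a`, `b` of a point close to infinity is dominated
`2`-adically by its term in `b` or, in the absence of that term, by its part linear in `X`. -/
theorem linearForm_ne_zero {X Y Z α β γ : ℤ} (hX : Odd X) (hY : Odd Y) (hZ : (16 : ℤ) ∣ Z)
    (hZ0 : Z ≠ 0) (h : ¬ (16 : ℤ) ∣ γ ∨ γ = 0 ∧ ¬ (16 : ℤ) ∣ 13 * β - 10 * α) :
    α * (-10 * X * Z) + β * (Z * (13 * X + 1332 * Z ^ 2)) + γ * (3 * Y) ≠ 0 := by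
  intro h0
  have hcop {W : ℤ} (hW : Odd W) : IsCoprime (16 : ℤ) W := by
    have := (Int.isCoprime_two_left.2 hW).pow_left (m := 4)
    norm_num at this
    exact this
  rcases h with h | ⟨rfl, h⟩
  · have h3 : Odd (3 * Y) := Odd.mul (by decide) hY
    refine h ((hcop h3).dvd_of_dvd_mul_right ?_)
    have : γ * (3 * Y) = Z * (10 * α * X - β * (13 * X + 1332 * Z ^ 2)) := by
      linear_combination h0
    rw [this]
    exact hZ.mul_right _
  · refine h ((hcop hX).dvd_of_dvd_mul_right ?_)
    have h1 : Z * ((13 * β - 10 * α) * X + 1332 * β * Z ^ 2) = 0 := by linear_combination h0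
    have h2 := (mul_eq_zero.1 h1).resolve_left hZ0
    have : (13 * β - 10 * α) * X = Z * (-1332 * β * Z) := by linear_combination h2
    rw [this]
    exact hZ.mul_right _

theorem isNontrivial_pointSide {X Y Z : ℤ} (hX : Odd X) (hY : Odd Y) (hZ : (16 : ℤ) ∣ Z)
    (hZ0 : Z ≠ 0) : IsNontrivial (pointSide X Y Z) (pointSide X (-Y) Z) := by
  have key (α β γ : ℤ) (h : ¬ (16 : ℤ) ∣ γ ∨ γ = 0 ∧ ¬ (16 : ℤ) ∣ 13 * β - 10 * α) (Y : ℤ)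
      (hY : Odd Y) := linearForm_ne_zero hX hY hZ hZ0 h
  have hadd (Y : ℤ) (hY : Odd Y) (i j) : pointSide X Y Z i + pointSide X Y Z j ≠ 0 := by
    have := key (![8, 8, 8, 4, 4, 4] i + ![8, 8, 8, 4, 4, 4] j)
      (![2, 5, -7, -2, -5, 7] i + ![2, 5, -7, -2, -5, 7] j)
      (![4, -3, -1, -4, 3, 1] i + ![4, -3, -1, -4, 3, 1] j) (by revert i j; decide) Y hY
    intro h
    apply this
    unfold pointSide side at h
    linear_combination h
  refine ⟨fun i j h ↦ ?_, hadd Y hY, hadd (-Y) hY.neg⟩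
  refine key (![8, 8, 8, 4, 4, 4] i - ![8, 8, 8, 4, 4, 4] j)
      (![2, 5, -7, -2, -5, 7] i - ![2, 5, -7, -2, -5, 7] j)
      (![4, -3, -1, -4, 3, 1] i + ![4, -3, -1, -4, 3, 1] j) (by clear h; revert i j; decide) Y hY ?_
  unfold pointSide side at h
  linear_combination h

/-! ### Primitive solutions -/

theorem exists_primitive_of_ne_zero {x y : Fin 6 → ℤ} (hx : x ≠ 0) :
    ∃ (g : ℤ) (x' y' : Fin 6 → ℤ), g ≠ 0 ∧ (∀ i, x i = g * x' i) ∧ (∀ i, y i = g * y' i) ∧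
      IsPrimitive x' y' := by
  obtain ⟨f, hf, hgcd⟩ := Finset.univ.extract_gcd (Sum.elim x y) ⟨Sum.inl 0, Finset.mem_univ _⟩
  refine ⟨_, fun i ↦ f (.inl i), fun i ↦ f (.inr i), ?_,
    fun i ↦ hf (.inl i) (Finset.mem_univ _), fun i ↦ hf (.inr i) (Finset.mem_univ _), ?_⟩
  · intro h0
    refine hx (funext fun i ↦ ?_)
    simpa [h0] using hf (.inl i) (Finset.mem_univ _)
  · intro d hd
    refine isUnit_of_dvd_one (hgcd ▸ Finset.dvd_gcd fun i _ ↦ ?_)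
    rcases i with i | i
    exacts [(hd i).1, (hd i).2]

theorem IsSolution.of_mul {g : ℤ} {x y x' y' : Fin 6 → ℤ} (hg : g ≠ 0) (hx : ∀ i, x i = g * x' i)
    (hy : ∀ i, y i = g * y' i) (h : IsSolution x y) : IsSolution x' y' := by
  intro k hk
  have := h k hk
  simp only [hx, hy, mul_pow, ← Finset.mul_sum] at this
  exact mul_left_cancel₀ (pow_ne_zero k hg) this

theorem IsNontrivial.of_mul {g : ℤ} {x y x' y' : Fin 6 → ℤ} (hx : ∀ i, x i = g * x' i)
    (hy : ∀ i, y i = g * y' i) (h : IsNontrivial x y) : IsNontrivial x' y' := by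
  refine ⟨fun i j e ↦ h.1 i j ?_, fun i j e ↦ h.2.1 i j ?_, fun i j e ↦ h.2.2 i j ?_⟩
  · rw [hx, hy, e]
  · rw [hx, hx, ← mul_add, e, mul_zero]
  · rw [hy, hy, ← mul_add, e, mul_zero]

theorem eq_of_odd_mul_two_pow_eq {A B : ℤ} (hA : Odd A) (hB : Odd B) {m n : ℕ}
    (h : A * 2 ^ m = B * 2 ^ n) : m = n := by
  have le_of_eq {A B : ℤ} (hA : Odd A) {m n : ℕ} (h : A * 2 ^ m = B * 2 ^ n) : n ≤ m := by
    have : IsCoprime ((2 : ℤ) ^ n) A := (Int.isCoprime_two_left.2 hA).pow_left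
    exact (pow_dvd_pow_iff (by norm_num) (by decide)).1
      (this.dvd_of_dvd_mul_left (Dvd.intro_left B h.symm))
  exact le_antisymm (le_of_eq hB h.symm) (le_of_eq hA h)

/-- Solutions of the family attached to points whose denominators have different `2`-adic
valuations are not proportional. -/
theorem eq_of_proportional {X Y X₁ Y₁ w w₁ g g₁ : ℤ} {k k₁ : ℕ} {x y : Fin 6 → ℤ} (hX : Odd X)
    (hX₁ : Odd X₁) (hw : Odd w) (hw₁ : Odd w₁)
    (hx : ∀ i, pointSide X Y (2 ^ k * w) i = g * x i)
    (hy : ∀ i, pointSide X (-Y) (2 ^ k * w) i = g * y i)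
    (hx₁ : ∀ i, pointSide X₁ Y₁ (2 ^ k₁ * w₁) i = g₁ * x i)
    (hy₁ : ∀ i, pointSide X₁ (-Y₁) (2 ^ k₁ * w₁) i = g₁ * y i) : k = k₁ := by
  have h1 := hx 0
  have h2 := hx 3
  have h3 := hy 3
  have h4 := hx₁ 0
  have h5 := hx₁ 3
  have h6 := hy₁ 3
  have hZ : (2 : ℤ) ^ k * w ≠ 0 := mul_ne_zero (by positivity) fun h ↦ by simp [h] at hw
  have hZ₁ : (2 : ℤ) ^ k₁ * w₁ ≠ 0 := mul_ne_zero (by positivity) fun h ↦ by simp [h] at hw₁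
  obtain ⟨Z, hZe⟩ : ∃ Z, Z = 2 ^ k * w := ⟨_, rfl⟩
  obtain ⟨Z₁, hZe₁⟩ : ∃ Z₁, Z₁ = 2 ^ k₁ * w₁ := ⟨_, rfl⟩
  rw [← hZe] at h1 h2 h3 hZ
  rw [← hZe₁] at h4 h5 h6 hZ₁
  simp [pointSide, side] at h1 h2 h3 h4 h5 h6
  -- The sum of the terms `0` and `3` is `12 c`, and the difference of term `0` on one side and
  -- term `3` on the other is `4 (c + a)`.
  have e1 : -120 * X * Z = g * (x 0 + x 3) := by linear_combination h1 + h2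
  have e2 : 4 * Z * (3 * X + 1332 * Z ^ 2) = g * (x 0 - y 3) := by linear_combination h1 - h3
  have e3 : -120 * X₁ * Z₁ = g₁ * (x 0 + x 3) := by linear_combination h4 + h5
  have e4 : 4 * Z₁ * (3 * X₁ + 1332 * Z₁ ^ 2) = g₁ * (x 0 - y 3) := by
    linear_combination h4 - h6
  have e : X * Z₁ ^ 2 = X₁ * Z ^ 2 := by
    refine mul_left_cancel₀ (mul_ne_zero (mul_ne_zero (by norm_num : (-639360 : ℤ) ≠ 0) hZ) hZ₁) ?_
    linear_combination (4 * Z₁ * (3 * X₁ + 1332 * Z₁ ^ 2)) * e1 + g * (x 0 + x 3) * e4 -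
      (4 * Z * (3 * X + 1332 * Z ^ 2)) * e3 - g₁ * (x 0 + x 3) * e2
  rw [hZe, hZe₁] at e
  have := eq_of_odd_mul_two_pow_eq (hX.mul (hw₁.pow (n := 2))) (hX₁.mul (hw.pow (n := 2)))
    (m := 2 * k₁) (n := 2 * k) (by linear_combination e)
  omega

theorem mainTheorem1 :
    {p : (Fin 6 → ℤ) × (Fin 6 → ℤ) |
      IsSolution p.1 p.2 ∧ IsNontrivial p.1 p.2 ∧ IsPrimitive p.1 p.2}.Infinite := by
  choose X Y w hX hY hw hcurve using exists_odd_point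
  have hZ0 (k : ℕ) : (2 : ℤ) ^ (k + 4) * w (k + 1) ≠ 0 :=
    mul_ne_zero (by positivity) fun h ↦ by simpa [h] using hw (k + 1)
  -- The first point has denominator `8`, while nontriviality is deduced from divisibility by `16`.
  have hnon (k : ℕ) := isNontrivial_pointSide (hX (k + 1)) (hY (k + 1))
    (Dvd.intro_left (2 ^ k * w (k + 1)) (by ring)) (hZ0 k)
  have hne (k : ℕ) : pointSide (X (k + 1)) (Y (k + 1)) (2 ^ (k + 4) * w (k + 1)) ≠ 0 :=
    fun h ↦ (hnon k).2.1 0 0 (by simp [h])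
  choose g x y hg hx hy hprim using fun k ↦ exists_primitive_of_ne_zero
    (y := pointSide (X (k + 1)) (-Y (k + 1)) (2 ^ (k + 4) * w (k + 1))) (hne k)
  refine Set.infinite_of_injective_forall_mem (f := fun k : ℕ ↦ (x k, y k)) ?_ fun k ↦
    ⟨(hcurve (k + 1)).isSolution.of_mul (hg k) (hx k) (hy k), (hnon k).of_mul (hx k) (hy k),
      hprim k⟩
  intro k l hkl
  obtain ⟨h1, h2⟩ := Prod.mk.inj hkl
  have := eq_of_proportional (hX (k + 1)) (hX (l + 1)) (hw (k + 1)) (hw (l + 1)) (hx k) (hy k)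
    (h1 ▸ hx l) (h2 ▸ hy l)
  omega
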